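/- Let $\mathbb K$ be $\mathbb R$ or $\mathbb C$, let $\Omega$ be an uncountable locally compact Polish space, and let $\kappa$ be any ordinal of cardinality $\mathfrak c=2^{\aleph_0}$. Write $\mathbf Z(f)=\{x\in\Omega: f(x)=0\}$ for $f\in C(\Omega)=C(\Omega,\mathbb K)$, and $\mathbf Z[\Omega]=\{\mathbf Z(f): f\in C(\Omega)\}$ for the family of zero sets. A *$z$-filter* on $\Omega$ is a non-empty proper subset of $\mathbf Z[\Omega]$ closed under finite intersections and under supersets in $\mathbf Z[\Omega]$; a $z$-filter $\mathcal P$ is *prime* if $Z_1\cup Z_2\notin\mathcal P$ whenever $Z_1,Z_2\in\mathbf Z[\Omega]\setminus\mathcal P$. Let $C_0(\Omega)$ be the ring of continuous functions $\Omega\to\mathbb K$ vanishing at infinity. A proper ideal $I$ of $C_0(\Omega)$ is a *prime $z$-ideal* if it is prime ($fg\in I$ implies $f\in I$ or $g\in I$) and $g\in I$ whenever $g\in C_0(\Omega)$, $f\in I$ and $\mathbf Z(f)\subseteq\mathbf Z(g)$. Then there exists a family $(\mathcal Q_\alpha)_{\alpha<\kappa}$ of prime $z$-filters on $\Omega$ that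 is a well-ordered increasing chain of order type $\kappa$, that is, $\mathcal Q_\alpha\subsetneq\mathcal Q_\beta$ whenever $\alpha<\beta<\kappa$. Furthermore, setting $$Q_\alpha=\{f\in C_0(\Omega): \mathbf Z(f)\in\mathcal Q_\alpha\}\qquad(\alpha<\kappa),$$ each $Q_\alpha$ is a prime $z$-ideal of $C_0(\Omega)$, and $(Q_\alpha)_{\alpha<\kappa}$ is also a well-ordered increasing chain of order type $\kappa$: $Q_\alpha\subsetneq Q_\beta$ whenever $\alpha<\beta<\kappa$. -/

import Mathlib

open scoped ZeroAtInfty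

universe u v

/-- `Z ⊆ Ω` is a zero set, i.e. `Z = {x | f x = 0}` for a continuous `f : Ω → 𝕜`. -/
def IsZeroSet (𝕜 : Type*) [RCLike 𝕜] {Ω : Type*} [TopologicalSpace Ω] (Z : Set Ω) : Prop :=
  ∃ f : C(Ω, 𝕜), Z = {x | f x = 0}

/-- A `z`-filter on `Ω`: a non-empty proper subfamily of the family of all zero sets, closed under
finite intersections and under zero supersets. -/
structure IsZFilter (𝕜 : Type*) [RCLike 𝕜] {Ω : Type*} [TopologicalSpace Ω]
    (F : Set (Set Ω)) : Prop where
  isZeroSet : ∀ Z ∈ F, IsZeroSet 𝕜 Z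
  nonempty : F.Nonempty
  proper : F ≠ {Z | IsZeroSet 𝕜 Z}
  inter_mem : ∀ Z₁ ∈ F, ∀ Z₂ ∈ F, Z₁ ∩ Z₂ ∈ F
  superset_mem : ∀ Z₁ ∈ F, ∀ Z₂, IsZeroSet 𝕜 Z₂ → Z₁ ⊆ Z₂ → Z₂ ∈ F

/-- A prime `z`-filter: the union of two zero sets that are not members is not a member. -/
structure IsPrimeZFilter (𝕜 : Type*) [RCLike 𝕜] {Ω : Type*} [TopologicalSpace Ω]
    (F : Set (Set Ω)) : Prop extends IsZFilter 𝕜 F where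
  union_notMem : ∀ Z₁ Z₂, IsZeroSet 𝕜 Z₁ → IsZeroSet 𝕜 Z₂ → Z₁ ∉ F → Z₂ ∉ F → Z₁ ∪ Z₂ ∉ F

/-- A prime `z`-ideal of the (commutative, possibly non-unital) ring `C₀(Ω, 𝕜)`: a proper prime
ideal `I` such that `g ∈ I` whenever the zero set of `g` contains the zero set of some `f ∈ I`. -/
structure IsPrimeZIdeal {𝕜 : Type*} [RCLike 𝕜] {Ω : Type*} [TopologicalSpace Ω]
    (I : TwoSidedIdeal C₀(Ω, 𝕜)) : Prop where
  ne_top : I ≠ ⊤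
  mem_or_mem : ∀ f g : C₀(Ω, 𝕜), f * g ∈ I → f ∈ I ∨ g ∈ I
  mem_of_zeroSet_subset : ∀ f g : C₀(Ω, 𝕜), f ∈ I → {x | f x = 0} ⊆ {x | g x = 0} → g ∈ I

/-! In a metrizable space zero sets are the closed sets, so it suffices to find chains of prime
filters of closed sets. Suppose closed sets `Z a`, indexed by a linear order, share a point, and
each `Z b` has dense complement in every finite intersection of the others. Then some increasing
family of prime filters satisfies `Z a ∈ F β ↔ a < β`: finitely many indices are handled by limits
of filters along ultrafilters of points, all indices by one more ultrafilter limit. Cantor space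
carries continuum many such sets, from almost disjoint branches of the binary tree. A continuous
injection into `Ω` carries the chain over, and σ-compactness makes every zero set that of a `C₀`
function. -/

open Filter Topology

/-! ### Chains of prime filters of closed sets -/

section PrimeClosedFilter

/-- A prime filter of the lattice of closed sets of a topological space. -/
structure IsPrimeClosedFilter {X : Type*} [TopologicalSpace X] (F : Set (Set X)) : Prop where
  isClosed : ∀ A ∈ F, IsClosed A
  univ_mem : Set.univ ∈ F
  empty_notMem : ∅ ∉ F
  inter_mem : ∀ A ∈ F, ∀ B ∈ F, A ∩ B ∈ F
  superset_mem : ∀ A ∈ F, ∀ B, IsClosed B → A ⊆ B → B ∈ F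
  mem_or_mem : ∀ A B, IsClosed A → IsClosed B → A ∪ B ∈ F → A ∈ F ∨ B ∈ F

variable {X Y ι I : Type*} [TopologicalSpace X] [TopologicalSpace Y]

theorem isPrimeClosedFilter_point (x : X) : IsPrimeClosedFilter {A : Set X | IsClosed A ∧ x ∈ A} where
  isClosed _ h := h.1
  univ_mem := ⟨isClosed_univ, trivial⟩
  empty_notMem h := h.2
  inter_mem _ hA _ hB := ⟨hA.1.inter hB.1, hA.2, hB.2⟩
  superset_mem _ hA _ hB h := ⟨hB, h hA.2⟩
  mem_or_mem _ _ hA hB h := h.2.imp (fun h => ⟨hA, h⟩) (fun h => ⟨hB, h⟩)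

/-- The limit of a family of prime filters of closed sets along an ultrafilter. -/
theorem IsPrimeClosedFilter.ultrafilterLim (U : Ultrafilter ι) {F : ι → Set (Set X)}
    (hF : ∀ᶠ i in U, IsPrimeClosedFilter (F i)) :
    IsPrimeClosedFilter {A | ∀ᶠ i in U, A ∈ F i} where
  isClosed A h := by
    obtain ⟨i, hi, hA⟩ := (hF.and h).exists
    exact hi.isClosed A hA
  univ_mem := hF.mono fun i hi => hi.univ_mem
  empty_notMem h := by
    obtain ⟨i, hi, hA⟩ := (hF.and h).exists
    exact hi.empty_notMem hA
  inter_mem A hA B hB := by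
    filter_upwards [hF, hA, hB] with i hi h₁ h₂ using hi.inter_mem A h₁ B h₂
  superset_mem A hA B hB h := by
    filter_upwards [hF, hA] with i hi h₁ using hi.superset_mem A h₁ B hB h
  mem_or_mem A B hA hB h := by
    refine Ultrafilter.eventually_or.1 ?_
    filter_upwards [hF, h] with i hi h₁ using hi.mem_or_mem A B hA hB h₁

theorem IsPrimeClosedFilter.map {F : Set (Set X)} (hF : IsPrimeClosedFilter F) {e : X → Y}
    (he : Continuous e) : IsPrimeClosedFilter {B : Set Y | IsClosed B ∧ e ⁻¹' B ∈ F} where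
  isClosed _ h := h.1
  univ_mem := ⟨isClosed_univ, hF.univ_mem⟩
  empty_notMem h := hF.empty_notMem h.2
  inter_mem _ hA _ hB := ⟨hA.1.inter hB.1, hF.inter_mem _ hA.2 _ hB.2⟩
  superset_mem _ hA _ hB h :=
    ⟨hB, hF.superset_mem _ hA.2 _ (hB.preimage he) (Set.preimage_mono h)⟩
  mem_or_mem _ _ hA hB h :=
    (hF.mem_or_mem _ _ (hA.preimage he) (hB.preimage he) h.2).imp
      (fun h => ⟨hA, h⟩) (fun h => ⟨hB, h⟩)

variable [LinearOrder I]

/-- If each `Z b` has dense complement in every finite intersection of the other `Z a`, then every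
point of a finite intersection carries a chain of prime filters separating these finitely many
sets. -/
theorem exists_monotone_isPrimeClosedFilter_finset {Z : I → Set X} (hZ : ∀ a, IsClosed (Z a))
    (hd : ∀ (s : Finset I) (b : I), b ∉ s → (⋂ a ∈ s, Z a) ⊆ closure ((⋂ a ∈ s, Z a) \ Z b))
    (s : Finset I) : ∀ x ∈ ⋂ a ∈ s, Z a, ∃ F : I → Set (Set X),
      (∀ β, IsPrimeClosedFilter (F β)) ∧ Monotone F ∧ (∀ β, ∀ A ∈ F β, x ∈ A) ∧
      ∀ a ∈ s, ∀ β, Z a ∈ F β ↔ a < β := by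
  induction s using Finset.induction_on_max with
  | empty =>
    intro x _
    exact ⟨fun _ => {A | IsClosed A ∧ x ∈ A}, fun _ => isPrimeClosedFilter_point x,
      monotone_const, fun _ _ h => h.2, by simp⟩
  | insert b s hb ih =>
    intro x hx
    have hbs : b ∉ s := fun h => (hb b h).false
    have hxs : ∀ a ∈ insert b s, x ∈ Z a := by simpa only [Set.mem_iInter] using hx
    have hxc : x ∈ closure ((⋂ a ∈ s, Z a) \ Z b) := hd s b hbs <| by
      simp only [Set.mem_iInter]
      exact fun a ha => hxs a (Finset.mem_insert_of_mem ha)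
    -- Points `y` off `Z b` tend to `x` along `U`; the induction hypothesis supplies a chain at
    -- each.
    obtain ⟨U, hUW, hUx⟩ := mem_closure_iff_ultrafilter.1 hxc
    choose! G hG hGmono hGmem hGsep using ih
    have hU : ∀ᶠ y in U, y ∈ (⋂ a ∈ s, Z a) \ Z b := hUW
    have hlim : ∀ β, ∀ A ∈ {A | ∀ᶠ y in (U : Filter X), A ∈ G y β}, IsClosed A ∧ x ∈ A := by
      intro β A hA
      have hAc : IsClosed A :=
        (IsPrimeClosedFilter.ultrafilterLim U (hU.mono fun y hy => hG y hy.1 β)).isClosed A hA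
      refine ⟨hAc, hAc.mem_of_tendsto (b := (U : Filter X)) (f := id) hUx ?_⟩
      filter_upwards [hU, hA] with y hy hyA using hGmem y hy.1 β A hyA
    -- Above the maximum `b`, the point filter at `x` contains every `Z a`. Up to `b`, the limit of
    -- the chains at `y` omits `Z b`, since members of the filters at `y` contain `y ∉ Z b`. Members
    -- of the limit are closed and so contain `x`, which gives monotonicity across `b`.
    refine ⟨fun β => if b < β then {A | IsClosed A ∧ x ∈ A} else
      {A | ∀ᶠ y in (U : Filter X), A ∈ G y β}, fun β => ?_, fun β γ hβγ => ?_, fun β A hA => ?_,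
      fun a ha β => ?_⟩
    · dsimp only
      split_ifs
      · exact isPrimeClosedFilter_point x
      · exact IsPrimeClosedFilter.ultrafilterLim U (hU.mono fun y hy => hG y hy.1 β)
    · dsimp only
      split_ifs with h₁ h₂ h₂
      · exact le_rfl
      · exact absurd (h₁.trans_le hβγ) h₂
      · exact hlim β
      · intro A hA
        filter_upwards [hU, hA] with y hy hyA using hGmono y hy.1 hβγ hyA
    · dsimp only at hA
      split_ifs at hA
      · exact hA.2
      · exact (hlim β A hA).2
    · dsimp only
      split_ifs with h
      · have : a ≤ b := (Finset.mem_insert.1 ha).elim le_of_eq fun h => (hb a h).le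
        exact iff_of_true ⟨hZ a, hxs a ha⟩ (this.trans_lt h)
      · rcases Finset.mem_insert.1 ha with rfl | ha
        · refine iff_of_false (fun hA => ?_) h
          obtain ⟨y, hy, hyA⟩ := (hU.and hA).exists
          exact hy.2 (hGmem y hy.1 β _ hyA)
        · constructor
          · intro hA
            obtain ⟨y, hy, hyA⟩ := (hU.and hA).exists
            exact (hGsep y hy.1 a ha β).1 hyA
          · intro hlt
            exact hU.mono fun y hy => (hGsep y hy.1 a ha β).2 hlt

/-- The finite chains converge along an ultrafilter on finite index sets finer than `atTop`, for
which each index eventually belongs to the finite set. -/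
theorem exists_monotone_isPrimeClosedFilter {Z : I → Set X} (hZ : ∀ a, IsClosed (Z a))
    (hne : (⋂ a, Z a).Nonempty)
    (hd : ∀ (s : Finset I) (b : I), b ∉ s → (⋂ a ∈ s, Z a) ⊆ closure ((⋂ a ∈ s, Z a) \ Z b)) :
    ∃ F : I → Set (Set X), (∀ β, IsPrimeClosedFilter (F β)) ∧ Monotone F ∧
      ∀ a β, Z a ∈ F β ↔ a < β := by
  obtain ⟨x, hx⟩ := hne
  have hx' : ∀ s : Finset I, x ∈ ⋂ a ∈ s, Z a := fun s => by
    simp only [Set.mem_iInter] at hx ⊢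
    exact fun a _ => hx a
  choose G hG hGmono _ hGsep using fun s =>
    exists_monotone_isPrimeClosedFilter_finset hZ hd s x (hx' s)
  let U : Ultrafilter (Finset I) := Ultrafilter.of atTop
  have hU : ∀ a, ∀ᶠ s in (U : Filter (Finset I)), a ∈ s := fun a => Ultrafilter.of_le atTop <| by
    filter_upwards [eventually_ge_atTop ({a} : Finset I)] with s hs using hs (Finset.mem_singleton_self a)
  refine ⟨fun β => {A | ∀ᶠ s in U, A ∈ G s β},
    fun β => .ultrafilterLim U (.of_forall fun s => hG s β),
    fun β γ h A hA => hA.mono fun s hs => hGmono s h hs, fun a β => ⟨fun hA => ?_, fun h => ?_⟩⟩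
  · obtain ⟨s, hs, hsA⟩ := ((hU a).and hA).exists
    exact (hGsep s a hs β).1 hsA
  · exact (hU a).mono fun s hs => (hGsep s a hs β).2 h

end PrimeClosedFilter

/-! ### Independent closed sets in Cantor space -/

section Cantor

/-- A code for the initial segment of length `n` of a binary sequence. -/
def initialSegmentCode (t : ℕ → Bool) (n : ℕ) : ℕ :=
  Encodable.encode ((List.range n).map t)

theorem initialSegmentCode_eq {t u : ℕ → Bool} {m n : ℕ}
    (h : initialSegmentCode t m = initialSegmentCode u n) : m = n ∧ ∀ k < n, t k = u k := by
  have h' := Encodable.encode_injective h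
  have hmn : m = n := by simpa using congrArg List.length h'
  subst hmn
  exact ⟨rfl, fun k hk => List.map_inj_left.1 h' k (List.mem_range.2 hk)⟩

theorem eventually_initialSegmentCode_notMem_range {t u : ℕ → Bool} (h : t ≠ u) :
    ∀ᶠ n in atTop, initialSegmentCode t n ∉ Set.range (initialSegmentCode u) := by
  obtain ⟨k, hk⟩ := Function.ne_iff.1 h
  filter_upwards [eventually_gt_atTop k] with n hn
  rintro ⟨m, hm⟩
  obtain ⟨rfl, h'⟩ := initialSegmentCode_eq hm
  exact hk (h' k hn).symm

/-- The binary sequences vanishing on all codes of initial segments of `t`. -/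
def branchZeroSet (t : ℕ → Bool) : Set (ℕ → Bool) :=
  {x | ∀ n, x (initialSegmentCode t n) = false}

theorem isClosed_branchZeroSet (t : ℕ → Bool) : IsClosed (branchZeroSet t) := by
  simp only [branchZeroSet, Set.ofPred_forall]
  exact isClosed_iInter fun n => isClosed_eq (continuous_apply _) continuous_const

/-- Setting `x` to `true` at the code of a long initial segment of `t b` leaves `branchZeroSet (t
b)` but meets no code from the finitely many other branches; as the length grows, the modified
points tend to `x`. -/
theorem biInter_branchZeroSet_subset_closure {I : Type*} {t : I → ℕ → Bool}
    (ht : Function.Injective t) (s : Finset I) (b : I) (hb : b ∉ s) :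
    (⋂ a ∈ s, branchZeroSet (t a)) ⊆
      closure ((⋂ a ∈ s, branchZeroSet (t a)) \ branchZeroSet (t b)) := by
  intro x hx
  have hinj : Function.Injective (initialSegmentCode (t b)) := fun m n h =>
    (initialSegmentCode_eq h).1
  refine mem_closure_of_tendsto (b := atTop)
    (f := fun n => Function.update x (initialSegmentCode (t b) n) true) ?_ ?_
  · refine tendsto_pi_nhds.2 fun m => tendsto_const_nhds.congr' ?_
    have : ∀ᶠ n in atTop, initialSegmentCode (t b) n ≠ m := by
      rw [← Nat.cofinite_eq_atTop]
      exact hinj.tendsto_cofinite.eventually (eventually_cofinite_ne m)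
    filter_upwards [this] with n hn
    rw [Function.update_of_ne hn.symm]
  · have : ∀ᶠ n in atTop, ∀ a ∈ s,
        initialSegmentCode (t b) n ∉ Set.range (initialSegmentCode (t a)) :=
      (Filter.eventually_all_finset s).2 fun a ha =>
        eventually_initialSegmentCode_notMem_range fun h => hb (ht h ▸ ha)
    filter_upwards [this] with n hn
    simp only [Set.mem_iInter] at hx
    refine ⟨Set.mem_iInter₂.2 fun a ha k => ?_, fun h => ?_⟩
    · rw [Function.update_of_ne fun h => hn a ha ⟨k, h⟩]
      exact hx a ha k
    · simpa using h n

end Cantor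

/-! ### Zero sets and ideals of `C₀` -/

section ZeroSets

variable {Ω : Type*} [TopologicalSpace Ω] {𝕜 : Type*} [RCLike 𝕜]

theorem IsZeroSet.isClosed {Z : Set Ω} (h : IsZeroSet 𝕜 Z) : IsClosed Z := by
  obtain ⟨f, rfl⟩ := h
  exact isClosed_eq f.continuous continuous_const

theorem IsClosed.isZeroSet [TopologicalSpace.MetrizableSpace Ω] {Z : Set Ω} (h : IsClosed Z) :
    IsZeroSet 𝕜 Z := by
  let := TopologicalSpace.metrizableSpaceMetric Ω
  rcases Z.eq_empty_or_nonempty with rfl | hne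
  · exact ⟨1, by simp⟩
  · refine ⟨⟨fun x => (Metric.infDist x Z : 𝕜),
      RCLike.continuous_ofReal.comp (Metric.continuous_infDist_pt Z)⟩, ?_⟩
    ext x
    simp [h.mem_iff_infDist_zero hne]

theorem IsPrimeClosedFilter.isPrimeZFilter [TopologicalSpace.MetrizableSpace Ω]
    {F : Set (Set Ω)} (hF : IsPrimeClosedFilter F) : IsPrimeZFilter 𝕜 F where
  isZeroSet Z hZ := (hF.isClosed Z hZ).isZeroSet
  nonempty := ⟨_, hF.univ_mem⟩
  proper h := hF.empty_notMem (h ▸ isClosed_empty.isZeroSet (𝕜 := 𝕜))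
  inter_mem := hF.inter_mem
  superset_mem A hA B hB h := hF.superset_mem A hA B hB.isClosed h
  union_notMem A B hA hB hA' hB' h :=
    (hF.mem_or_mem A B hA.isClosed hB.isClosed h).elim hA' hB'

/-- A continuous real function tending to infinity at infinity. -/
theorem exists_continuousMap_tendsto_cocompact_atTop [T2Space Ω] [LocallyCompactSpace Ω]
    [SigmaCompactSpace Ω] : ∃ g : C(Ω, ℝ), (∀ x, 0 ≤ g x) ∧ Tendsto g (cocompact Ω) atTop := by
  let K : CompactExhaustion Ω := default
  -- The index `K.find` is locally bounded, so a partition of unity yields a continuous majorant.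
  obtain ⟨g, hg⟩ := exists_continuous_forall_mem_convex_of_local_const
    (t := fun x => Set.Ici (K.find x : ℝ)) (fun x => convex_Ici _) fun x =>
      ⟨(K.find x + 1 : ℕ), by
        filter_upwards [mem_interior_iff_mem_nhds.1
          (K.subset_interior_succ (K.find x) (K.mem_find x))] with y hy
        exact Nat.cast_le (α := ℝ).2 (K.mem_iff_find_le.1 hy)⟩
  refine ⟨g, fun x => (Nat.cast_nonneg _).trans (hg x), tendsto_atTop.2 fun c => ?_⟩
  obtain ⟨n, hn⟩ := exists_nat_ge c
  filter_upwards [(K.isCompact n).compl_mem_cocompact] with x hx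
  have : n ≤ K.find x := le_of_not_ge fun h => hx (K.mem_iff_find_le.2 h)
  exact hn.trans ((Nat.cast_le (α := ℝ).2 this).trans (hg x))

theorem IsZeroSet.exists_zeroAtInfty [T2Space Ω] [LocallyCompactSpace Ω] [SigmaCompactSpace Ω]
    {Z : Set Ω} (h : IsZeroSet 𝕜 Z) : ∃ f : C₀(Ω, 𝕜), {x | f x = 0} = Z := by
  obtain ⟨f, rfl⟩ := h
  obtain ⟨g, hg, hlim⟩ := exists_continuousMap_tendsto_cocompact_atTop (Ω := Ω)
  have hpos : ∀ x, 0 < 1 + g x := fun x => by linarith [hg x]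
  -- The truncated norm is bounded with the zeros of `f`; the positive factor forces decay at
  -- infinity.
  let k : Ω → ℝ := fun x => (1 + g x)⁻¹ * min ‖f x‖ 1
  have hk : Continuous k :=
    ((continuous_const.add g.continuous).inv₀ fun x => (hpos x).ne').mul
      (f.continuous.norm.min continuous_const)
  have hk0 : Tendsto k (cocompact Ω) (𝓝 0) := by
    refine squeeze_zero (fun x => ?_) (fun x => ?_)
      ((tendsto_atTop_add_const_left _ 1 hlim).inv_tendsto_atTop)
    · exact mul_nonneg (inv_nonneg.2 (hpos x).le) (le_min (norm_nonneg _) zero_le_one)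
    · exact mul_le_of_le_one_right (inv_nonneg.2 (hpos x).le) (min_le_right _ _)
  refine ⟨⟨⟨fun x => (k x : 𝕜), RCLike.continuous_ofReal.comp hk⟩, ?_⟩, ?_⟩
  · simpa [Function.comp_def] using ((RCLike.continuous_ofReal (K := 𝕜)).tendsto 0).comp hk0
  · ext x
    have : (k x : 𝕜) = 0 ↔ f x = 0 := by
      rw [RCLike.ofReal_eq_zero, mul_eq_zero, or_iff_right (inv_ne_zero (hpos x).ne')]
      rcases min_choice ‖f x‖ 1 with h | h
      · rw [h, norm_eq_zero]
      · rw [h]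
        refine iff_of_false one_ne_zero fun h0 => ?_
        rw [h0, norm_zero] at h
        norm_num at h
    exact this

theorem isZeroSet_zeroAtInfty (f : C₀(Ω, 𝕜)) : IsZeroSet 𝕜 {x | f x = 0} :=
  ⟨f.toContinuousMap, rfl⟩

/-- The ideal of `C₀(Ω, 𝕜)` of the functions whose zero set belongs to a given `z`-filter. -/
def IsZFilter.ideal {F : Set (Set Ω)} (hF : IsZFilter 𝕜 F) : TwoSidedIdeal C₀(Ω, 𝕜) :=
  have sup : ∀ {f g : C₀(Ω, 𝕜)}, {x | f x = 0} ∈ F → {x | f x = 0} ⊆ {x | g x = 0} →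
      {x | g x = 0} ∈ F := fun hf h => hF.superset_mem _ hf _ (isZeroSet_zeroAtInfty _) h
  TwoSidedIdeal.mk' {f | {x | f x = 0} ∈ F}
    (by
      obtain ⟨Z, hZ⟩ := hF.nonempty
      exact hF.superset_mem Z hZ _ (isZeroSet_zeroAtInfty _) fun x _ => rfl)
    (fun {f g} hf hg => hF.superset_mem _ (hF.inter_mem _ hf _ hg) _ (isZeroSet_zeroAtInfty _)
      fun x ⟨(h₁ : f x = 0), (h₂ : g x = 0)⟩ => by simp [h₁, h₂])
    (fun {f} hf => sup hf fun x (h : f x = 0) => by simp [h])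
    (fun {f g} hg => sup hg fun x (h : g x = 0) => by simp [h])
    (fun {f g} hf => sup hf fun x (h : f x = 0) => by simp [h])

theorem IsZFilter.mem_ideal {F : Set (Set Ω)} (hF : IsZFilter 𝕜 F) {f : C₀(Ω, 𝕜)} :
    f ∈ hF.ideal ↔ {x | f x = 0} ∈ F := by
  simp only [IsZFilter.ideal, TwoSidedIdeal.mem_mk', Set.mem_ofPred_eq]

theorem IsPrimeZFilter.isPrimeZIdeal_ideal [T2Space Ω] [LocallyCompactSpace Ω]
    [SigmaCompactSpace Ω] {F : Set (Set Ω)} (hF : IsPrimeZFilter 𝕜 F) :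
    IsPrimeZIdeal hF.toIsZFilter.ideal where
  ne_top h := hF.proper <| Set.Subset.antisymm hF.isZeroSet fun Z hZ => by
    obtain ⟨f, rfl⟩ := IsZeroSet.exists_zeroAtInfty hZ
    exact hF.mem_ideal.1 (h ▸ trivial)
  mem_or_mem f g h := by
    rw [hF.mem_ideal] at h
    simp only [hF.mem_ideal]
    by_contra! hfg
    refine hF.union_notMem _ _ (isZeroSet_zeroAtInfty f) (isZeroSet_zeroAtInfty g) hfg.1 hfg.2 ?_
    convert h using 1
    ext x
    simp
  mem_of_zeroSet_subset f g hf h :=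
    hF.mem_ideal.2 (hF.superset_mem _ (hF.mem_ideal.1 hf) _ (isZeroSet_zeroAtInfty g) h)

theorem IsZFilter.ideal_lt_ideal [T2Space Ω] [LocallyCompactSpace Ω] [SigmaCompactSpace Ω]
    {F G : Set (Set Ω)} (hF : IsZFilter 𝕜 F) (hG : IsZFilter 𝕜 G) (h : F < G) :
    hF.ideal < hG.ideal := by
  obtain ⟨hle, Z, hZG, hZF⟩ := Set.ssubset_iff_exists.1 h
  refine lt_of_le_not_ge (fun f hf => hG.mem_ideal.2 (hle (hF.mem_ideal.1 hf))) fun hge => ?_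
  obtain ⟨f, rfl⟩ := (hG.isZeroSet Z hZG).exists_zeroAtInfty
  exact hZF (hF.mem_ideal.1 (hge (hG.mem_ideal.2 hZG)))

end ZeroSets

/-- Images of the branch sets under the injection `e` are compact, hence closed, and pull back to
the branch sets, so they still separate the pushed-forward filters. -/
theorem exists_strictMono_isPrimeClosedFilter (Ω : Type*) [TopologicalSpace Ω] [PolishSpace Ω]
    [Uncountable Ω] {I : Type*} [LinearOrder I] {t : I → ℕ → Bool} (ht : Function.Injective t) :
    ∃ Q : I → Set (Set Ω), (∀ α, IsPrimeClosedFilter (Q α)) ∧ StrictMono Q := by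
  obtain ⟨e, -, he, hinj⟩ := (isClosed_univ (X := Ω)).exists_nat_bool_injection_of_not_countable
    Set.not_countable_univ
  obtain ⟨F, hF, hmono, hsep⟩ := exists_monotone_isPrimeClosedFilter
    (fun a => isClosed_branchZeroSet (t a))
    ⟨fun _ => false, Set.mem_iInter.2 fun a n => rfl⟩ (biInter_branchZeroSet_subset_closure ht)
  refine ⟨fun α => {B | IsClosed B ∧ e ⁻¹' B ∈ F α}, fun α => (hF α).map he, fun α β h => ?_⟩
  have hpre := Set.preimage_image_eq (branchZeroSet (t α)) hinj
  refine Set.ssubset_iff_exists.2 ⟨fun B hB => ⟨hB.1, hmono h.le hB.2⟩,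
    e '' branchZeroSet (t α), ⟨?_, ?_⟩, fun hB => ?_⟩
  · exact ((isClosed_branchZeroSet (t α)).isCompact.image he).isClosed
  · rw [hpre]
    exact (hsep α β).2 h
  · have := hB.2
    rw [hpre, hsep α α] at this
    exact this.false

theorem theorem5p6 (𝕜 : Type*) [RCLike 𝕜] (Ω : Type u) [TopologicalSpace Ω] [PolishSpace Ω]
    [LocallyCompactSpace Ω] [Uncountable Ω] (κ : Ordinal.{v}) (hκ : κ.card = Cardinal.continuum) :
    ∃ Q : Set.Iio κ → Set (Set Ω),
      (∀ α, IsPrimeZFilter 𝕜 (Q α)) ∧ StrictMono Q ∧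
      ∃ P : Set.Iio κ → TwoSidedIdeal C₀(Ω, 𝕜),
        (∀ α f, f ∈ P α ↔ {x | f x = 0} ∈ Q α) ∧
        (∀ α, IsPrimeZIdeal (P α)) ∧ StrictMono P := by
  have hcard : Cardinal.lift.{0} (Cardinal.mk (Set.Iio κ)) ≤
      Cardinal.lift.{v + 1} (Cardinal.mk (ℕ → Bool)) := by
    simp [Cardinal.mk_Iio_ordinal, hκ]
  obtain ⟨t⟩ := Cardinal.lift_mk_le'.1 hcard
  obtain ⟨Q, hQ, hmono⟩ := exists_strictMono_isPrimeClosedFilter Ω t.injective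
  have hQ' : ∀ α, IsPrimeZFilter 𝕜 (Q α) := fun α => (hQ α).isPrimeZFilter
  exact ⟨Q, hQ', hmono, fun α => (hQ' α).toIsZFilter.ideal, fun α f => (hQ' α).mem_ideal,
    fun α => (hQ' α).isPrimeZIdeal_ideal,
    fun α β h => IsZFilter.ideal_lt_ideal _ _ (hmono h)⟩
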